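/- Let $n \ge 4$ and let $\Delta_{n-1} = \mathrm{conv}(e_1,\dots,e_n) \subset \mathbb{R}^n$ be the standard simplex. A *combinatorial $(n,2)$-hypersimplex* is a polytope (the convex hull of finitely many points in some $\mathbb{R}^d$, not necessarily full-dimensional) whose face lattice is isomorphic to that of $\Delta_{n,2} = \mathrm{conv}\{x \in \{0,1\}^n : x_1 + \dots + x_n = 2\}$. Two polytopes $P \subset \mathbb{R}^d$ and $P' \subset \mathbb{R}^m$ are *projectively equivalent* if there is a map $\varphi(x) = \frac{Ax+b}{\langle c,x\rangle+\delta}$, with $A\in\mathbb{R}^{m\times d}$, $b\in\mathbb{R}^m$, $c\in\mathbb{R}^d$, $\delta\in\mathbb{R}$, such that $\langle c,x\rangle+\delta>0$ for all $x \in P$, the linear map $(x,t)\mapsto (Ax+tb,\langle c,x\rangle+t\delta)$ is injective on the linear span of $P\times\{1\}$, and $\varphi(P)=P'$. 1. For every choice of points $p_{ij}$ in the relative interior of the edge $[e_i,e_j]$ of $\Delta_{n-1}$, for $1 \le i < j \le n$, the polytope $\mathrm{conv}\{p_{ij} : 1 \le i < j \le n\}$ is a combinatorial $(n,2)$-hypersimplex.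 2. Conversely, every combinatorial $(n,2)$-hypersimplex is projectively equivalent to $\mathrm{conv}\{p_{ij} : 1 \le i < j \le n\}$ for some choice of points $p_{ij}$ in the relative interiors of the edges $[e_i,e_j]$ of $\Delta_{n-1}$, $1 \le i < j \le n$. -/

import Mathlib

/-- A (convex) polytope: the convex hull of a finite set of points. -/
def IsPolytope {E : Type*} [AddCommGroup E] [Module ℝ E] (P : Set E) : Prop :=
  ∃ S : Set E, S.Finite ∧ P = convexHull ℝ S

/-- The face lattice of `P ⊆ ℝᵈ`, ordered by inclusion. The faces are the empty set and the sets of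
maximizers over `P` of linear functionals (`P` itself arises from the functional `0`). -/
abbrev FaceLattice {d : ℕ} (P : Set (Fin d → ℝ)) : Type :=
  {F : Set (Fin d → ℝ) // IsExposed ℝ P F}

/-- The `(n,k)`-hypersimplex `Δ_{n,k} = conv {x ∈ {0,1}ⁿ : x₁ + ⋯ + xₙ = k}`. -/
def hypersimplex (n k : ℕ) : Set (Fin n → ℝ) :=
  convexHull ℝ {x | (∀ i, x i = 0 ∨ x i = 1) ∧ ∑ i, x i = (k : ℝ)}

/-- A combinatorial `(n,k)`-hypersimplex: a polytope, in some `ℝᵈ` and not necessarily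
full-dimensional, whose face lattice is isomorphic to that of `Δ_{n,k}`. -/
def IsCombinatorialHypersimplex (n k : ℕ) {d : ℕ} (P : Set (Fin d → ℝ)) : Prop :=
  IsPolytope P ∧ Nonempty (FaceLattice P ≃o FaceLattice (hypersimplex n k))

/-- `P` is mapped onto `Q` by an admissible projective transformation from the affine hull of `P` to
the affine hull of `Q`. The transformation is `x ↦ (A x + b) / (⟨c, x⟩ + δ)`, where
`L (x, t) = (A x + t b, ⟨c, x⟩ + t δ)` is linear; it is nonsingular on `aff P`, i.e. `L` is injective
on the linear span of `P × {1}`, and admissible for `P`, i.e. its denominator is positive on `P`. -/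
def ProjectivelyEquivalent {E F : Type*} [AddCommGroup E] [Module ℝ E] [AddCommGroup F] [Module ℝ F]
    (P : Set E) (Q : Set F) : Prop :=
  ∃ L : (E × ℝ) →ₗ[ℝ] (F × ℝ),
    Set.InjOn L (Submodule.span ℝ ((fun x : E => (x, (1 : ℝ))) '' P) : Set (E × ℝ)) ∧
    (∀ x ∈ P, 0 < (L (x, 1)).2) ∧
    (fun x : E => ((L (x, 1)).2)⁻¹ • (L (x, 1)).1) '' P = Q

/-- `p i j`, for `i < j`, is a point in the relative interior of the edge `[eᵢ, eⱼ]` of the standard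
simplex `conv(e₁, …, eₙ) ⊆ ℝⁿ`. The values `p i j` with `i ≥ j` are irrelevant. -/
def IsEdgePointChoice {n : ℕ} (p : Fin n → Fin n → (Fin n → ℝ)) : Prop :=
  ∀ i j, i < j → p i j ∈ openSegment ℝ (Pi.single i (1 : ℝ) : Fin n → ℝ) (Pi.single j (1 : ℝ))

/-- `conv {p_{ij} : 1 ≤ i < j ≤ n}`. -/
def edgePointHull {n : ℕ} (p : Fin n → Fin n → (Fin n → ℝ)) : Set (Fin n → ℝ) :=
  convexHull ℝ {x | ∃ i j, i < j ∧ x = p i j}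

open Set

/-! Both halves compare face sets: the sets of edges `ij` whose points lie on a common supporting
hyperplane. Write `p_ij = w_ij e_i + w_ji e_j`. Since the coordinates sum to a constant, a
supporting hyperplane is a vector `b` with `w_ij b_i + w_ji b_j ≤ 0` on all edges, so at most one
`b_k` is positive. Rescaling `b` then carries the face sets for one choice of positive weights to
those for any other, and the hypersimplex is the choice with all weights 1
(`IsFaceSet.weightedEdgePoint_congr`). Conversely, a lattice isomorphism labels points `v_ij`
spanning the polytope, with the same face sets (`exists_family_of_orderIso`). For each `k`, the
edges avoiding `k` form a face, cut out by a nonnegative functional `f_k` on the homogenization.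
Only `f_i` and `f_j` are nonzero at `v_ij`, so `(f_1, …, f_n) / ∑ f_k` sends `v_ij` into the open
edge `[e_i, e_j]`. Nonsingularity (`eq_zero_of_forall_apply_eq_zero`) comes from the star of a
vertex being a maximal proper face. -/

/-- `T` indexes the points of the family `v` that lie on some supporting hyperplane of the family;
the hyperplane may be disjoint from the family, or contain all of it. -/
def IsFaceSet {ι E : Type*} [AddCommGroup E] [Module ℝ E] (v : ι → E) (T : Set ι) : Prop :=
  ∃ (l : E →ₗ[ℝ] ℝ) (c : ℝ), (∀ i, l (v i) ≤ c) ∧ ∀ i, i ∈ T ↔ l (v i) = c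

theorem isFaceSet_empty {ι E : Type*} [AddCommGroup E] [Module ℝ E] (v : ι → E) :
    IsFaceSet v ∅ :=
  ⟨0, 1, fun _ => by simp, fun _ => by simp⟩

theorem mem_convexHull_range_iff {ι E : Type*} [Fintype ι] [AddCommGroup E] [Module ℝ E]
    {v : ι → E} {x : E} :
    x ∈ convexHull ℝ (range v) ↔
      ∃ w : ι → ℝ, (∀ i, 0 ≤ w i) ∧ ∑ i, w i = 1 ∧ ∑ i, w i • v i = x := by
  classical
  have hv : range v = Fintype.linearCombination ℝ v '' range fun i j : ι =>
      if i = j then (1 : ℝ) else 0 := by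
    rw [← range_comp]
    congr 1
    ext i
    simp [Fintype.linearCombination_apply]
  rw [hv, ← LinearMap.image_convexHull, convexHull_basis_eq_stdSimplex]
  constructor
  · rintro ⟨w, ⟨h0, h1⟩, rfl⟩
    exact ⟨w, h0, h1, rfl⟩
  · rintro ⟨w, h0, h1, rfl⟩
    exact ⟨w, ⟨h0, h1⟩, rfl⟩

theorem linearMap_le_of_mem_convexHull_range {ι E : Type*} [AddCommGroup E] [Module ℝ E]
    {v : ι → E} {l : E →ₗ[ℝ] ℝ} {c : ℝ} (h : ∀ i, l (v i) ≤ c) {x : E}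
    (hx : x ∈ convexHull ℝ (range v)) : l x ≤ c := by
  have : convexHull ℝ (range v) ⊆ {x | l x ≤ c} :=
    convexHull_min (by rintro _ ⟨i, rfl⟩; exact h i) (convex_halfSpace_le l.isLinear c)
  exact this hx

/-! ### Face lattices in terms of face sets -/

section FaceLattice

variable {ι : Type*} {d : ℕ}

theorem IsExposed.isFaceSet_of_subset {v : ι → Fin d → ℝ} {Q F : Set (Fin d → ℝ)}
    (hv : ∀ i, v i ∈ Q) (hF : IsExposed ℝ Q F) : IsFaceSet v {i | v i ∈ F} := by
  rcases F.eq_empty_or_nonempty with rfl | hne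
  · simpa using isFaceSet_empty v
  · obtain ⟨l, rfl⟩ := hF hne
    obtain ⟨x, hxQ, hx⟩ := hne
    refine ⟨l.toLinearMap, l x, fun i => hx _ (hv i), fun i => ?_⟩
    constructor
    · rintro ⟨-, h⟩
      exact le_antisymm (hx _ (hv i)) (h x hxQ)
    · intro h
      exact ⟨hv i, fun y hy => (hx y hy).trans h.ge⟩

/-- If a convex combination maximizes a functional, so does every point carrying nonzero weight. -/
theorem IsExposed.subset_convexHull_image [Fintype ι] {v : ι → Fin d → ℝ} {F : Set (Fin d → ℝ)}
    (hF : IsExposed ℝ (convexHull ℝ (range v)) F) :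
    F ⊆ convexHull ℝ (v '' {i | v i ∈ F}) := by
  classical
  intro x hxF
  obtain ⟨l, hl⟩ := hF ⟨x, hxF⟩
  have hx : x ∈ convexHull ℝ (range v) ∧ ∀ y ∈ convexHull ℝ (range v), l y ≤ l x := by
    rw [hl] at hxF; exact hxF
  obtain ⟨w, h0, h1, hw⟩ := mem_convexHull_range_iff.1 hx.1
  have hvQ : ∀ i, v i ∈ convexHull ℝ (range v) := fun i => subset_convexHull ℝ _ ⟨i, rfl⟩
  have hsum : ∑ i, w i * (l x - l (v i)) = 0 := by
    have : l x = ∑ i, w i * l (v i) := by rw [← hw]; simp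
    simp only [mul_sub, Finset.sum_sub_distrib, ← Finset.sum_mul, h1]
    rw [← this]; ring
  have hz := (Finset.sum_eq_zero_iff_of_nonneg
    (fun i _ => mul_nonneg (h0 i) (sub_nonneg.2 (hx.2 _ (hvQ i))))).1 hsum
  have hmem : ∀ i, w i ≠ 0 → v i ∈ F := by
    intro i hi
    have := (mul_eq_zero.1 (hz i (Finset.mem_univ i))).resolve_left hi
    rw [hl]
    exact ⟨hvQ i, fun y hy => (hx.2 y hy).trans (by linarith)⟩
  rw [← hw, ← Finset.sum_filter_of_ne (p := fun i => w i ≠ 0)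
    (fun i _ h h' => h (by rw [h', zero_smul]))]
  refine (convex_convexHull ℝ _).sum_mem (fun i _ => h0 i) ?_ ?_
  · rw [Finset.sum_filter_ne_zero, h1]
  · intro i hi
    exact subset_convexHull ℝ _ ⟨i, hmem i (Finset.mem_filter.1 hi).2, rfl⟩

theorem IsFaceSet.exists_isExposed {v : ι → Fin d → ℝ} {T : Set ι} (hT : IsFaceSet v T) :
    ∃ F, IsExposed ℝ (convexHull ℝ (range v)) F ∧ {i | v i ∈ F} = T := by
  obtain ⟨l, c, hle, hiff⟩ := hT
  -- If `c` is not attained this set is empty, which still counts as exposed.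
  refine ⟨{x ∈ convexHull ℝ (range v) | l x = c}, ?_, ?_⟩
  · rintro ⟨x, hx, hxc⟩
    refine ⟨l.toContinuousLinearMap, ?_⟩
    ext y
    constructor
    · rintro ⟨hy, hyc⟩
      exact ⟨hy, fun z hz => (linearMap_le_of_mem_convexHull_range hle hz).trans hyc.ge⟩
    · rintro ⟨hy, h⟩
      exact ⟨hy, le_antisymm (linearMap_le_of_mem_convexHull_range hle hy) (hxc ▸ h x hx)⟩
  · ext i
    rw [hiff]
    exact ⟨fun h => h.2, fun h => ⟨subset_convexHull ℝ _ ⟨i, rfl⟩, h⟩⟩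

/-- The face lattice of the convex hull of a finite family is the inclusion order on its face
sets. -/
noncomputable def faceLatticeIso [Fintype ι] (v : ι → Fin d → ℝ) :
    FaceLattice (convexHull ℝ (range v)) ≃o {T : Set ι // IsFaceSet v T} :=
  RelIso.ofSurjective
    (OrderEmbedding.ofMapLEIff
      (fun F : FaceLattice (convexHull ℝ (range v)) =>
        (⟨{i | v i ∈ F.1}, F.2.isFaceSet_of_subset fun i => subset_convexHull ℝ _ (mem_range_self i)⟩ :
          {T : Set ι // IsFaceSet v T}))
      (fun F G => by
        constructor
        · intro h
          refine F.2.subset_convexHull_image.trans (convexHull_min ?_ (G.2.convex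
            (convex_convexHull ℝ _)))
          rintro _ ⟨i, hi, rfl⟩
          exact h hi
        · intro h i hi
          exact h hi))
    (fun T => by
      obtain ⟨F, hF, hFT⟩ := T.2.exists_isExposed
      exact ⟨⟨F, hF⟩, Subtype.ext hFT⟩)

/-- A compact convex set whose face lattice is that of a finite point family in convex position is
the convex hull of a family with the same face sets. -/
theorem exists_family_of_orderIso [Fintype ι] {e : ℕ} {Q : Set (Fin d → ℝ)} {w : ι → Fin e → ℝ}
    (hQ : IsCompact Q) (hQc : Convex ℝ Q) (hw : ∀ i, IsFaceSet w {i})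
    (Ψ : FaceLattice Q ≃o {T : Set ι // IsFaceSet w T}) :
    ∃ v : ι → Fin d → ℝ, Q = convexHull ℝ (range v) ∧ ∀ T, IsFaceSet v T ↔ IsFaceSet w T := by
  have hbot : ∀ F : FaceLattice Q, (Ψ F).1 = ∅ → F.1 = ∅ := by
    intro F hF
    have : Ψ F ≤ Ψ ⟨∅, isExposed_empty⟩ := by
      change (Ψ F).1 ⊆ _
      rw [hF]; exact empty_subset _
    exact subset_empty_iff.1 (Ψ.le_iff_le.1 this)
  set A : ι → FaceLattice Q := fun i => Ψ.symm ⟨{i}, hw i⟩ with hA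
  have hAne : ∀ i, (A i).1.Nonempty := by
    intro i
    rw [nonempty_iff_ne_empty]
    intro h
    have : A i ≤ Ψ.symm ⟨∅, isFaceSet_empty w⟩ := by
      change (A i).1 ⊆ _
      rw [h]; exact empty_subset _
    have : ({i} : Set ι) ⊆ ∅ := Ψ.symm.le_iff_le.1 this
    exact this (mem_singleton i)
  choose v hv using hAne
  have hA_le : ∀ i F, A i ≤ F ↔ i ∈ (Ψ F).1 := by
    intro i F
    rw [hA, OrderIso.symm_apply_le]
    exact singleton_subset_iff
  -- `v i` is an arbitrary point of the atom `A i`. If it lies in `F`, then `A i ∩ F` is a nonempty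
  -- face below that atom, so its label set is exactly `{i}`.
  have hmem : ∀ i (F : FaceLattice Q), v i ∈ F.1 ↔ i ∈ (Ψ F).1 := by
    intro i F
    constructor
    · intro h
      have hB : IsExposed ℝ Q ((A i).1 ∩ F.1) := (A i).2.inter F.2
      let B : FaceLattice Q := ⟨_, hB⟩
      have hBA : Ψ B ≤ Ψ (A i) := Ψ.monotone (show B.1 ⊆ _ from inter_subset_left)
      have hBF : Ψ B ≤ Ψ F := Ψ.monotone (show B.1 ⊆ _ from inter_subset_right)
      rw [hA, OrderIso.apply_symm_apply] at hBA
      have hne : (Ψ B).1.Nonempty := by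
        rw [nonempty_iff_ne_empty]
        intro h'
        have := hbot B h'
        exact (this ▸ (⟨hv i, h⟩ : v i ∈ B.1) : v i ∈ (∅ : Set _))
      obtain ⟨j, hj⟩ := hne
      have hji : j = i := hBA hj
      exact hji ▸ hBF hj
    · intro h
      exact (hA_le i F).2 h (hv i)
  have hvQ : ∀ i, v i ∈ Q := fun i => (A i).2.subset (hv i)
  have hQv : Q = convexHull ℝ (range v) := by
    apply subset_antisymm
    -- Separate `x` from the hull by `l`. The face of `Q` maximizing `l` is nonempty, hence contains
    -- some `v i`, where `l` would be at least `l x`.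
    · intro x hx
      by_contra hxC
      obtain ⟨l, u, hlu, hux⟩ := geometric_hahn_banach_closed_point (convex_convexHull ℝ (range v))
        ((finite_range v).isClosed_convexHull ℝ) hxC
      obtain ⟨y, hy, hmax⟩ := hQ.exists_isMaxOn ⟨x, hx⟩ l.continuous.continuousOn
      let F : FaceLattice Q := ⟨l.toExposed Q, ContinuousLinearMap.toExposed.isExposed⟩
      have hyF : y ∈ F.1 := ⟨hy, fun z hz => hmax hz⟩
      have hne : (Ψ F).1.Nonempty := by
        rw [nonempty_iff_ne_empty]
        intro h'
        exact (hbot F h' ▸ hyF : y ∈ (∅ : Set _))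
      obtain ⟨i, hi⟩ := hne
      have h1 := ((hmem i F).2 hi).2 x hx
      have h2 := hlu (v i) (subset_convexHull ℝ _ ⟨i, rfl⟩)
      linarith
    · exact convexHull_min (by rintro _ ⟨i, rfl⟩; exact hvQ i) hQc
  refine ⟨v, hQv, fun T => ?_⟩
  have hΨ : ∀ F : FaceLattice Q, {i | v i ∈ F.1} = (Ψ F).1 := fun F => ext fun i => hmem i F
  constructor
  · intro hT
    obtain ⟨F, hF, rfl⟩ := hT.exists_isExposed
    rw [← hQv] at hF
    have := hΨ ⟨F, hF⟩
    simp only at this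
    rw [this]
    exact (Ψ ⟨F, hF⟩).2
  · intro hT
    have h := (Ψ.symm ⟨T, hT⟩).2.isFaceSet_of_subset hvQ
    rwa [hΨ, OrderIso.apply_symm_apply] at h

end FaceLattice

/-! ### Points on the edges of the simplex and independence of the weights -/

/-- The edges of the complete graph on `Fin n`. -/
abbrev EdgeIndex (n : ℕ) : Type := {q : Fin n × Fin n // q.1 < q.2}

/-- The point `w i j • eᵢ + w j i • eⱼ` for the edge `i < j`. -/
def weightedEdgePoint {n : ℕ} (w : Fin n → Fin n → ℝ) (q : EdgeIndex n) : Fin n → ℝ :=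
  Pi.single q.1.1 (w q.1.1 q.1.2) + Pi.single q.1.2 (w q.1.2 q.1.1)

section WeightedEdgePoint

variable {n : ℕ}

theorem map_weightedEdgePoint (l : (Fin n → ℝ) →ₗ[ℝ] ℝ) (w : Fin n → Fin n → ℝ)
    (q : EdgeIndex n) :
    l (weightedEdgePoint w q) =
      w q.1.1 q.1.2 * l (Pi.single q.1.1 1) + w q.1.2 q.1.1 * l (Pi.single q.1.2 1) := by
  have h : ∀ (i : Fin n) (r : ℝ), (Pi.single i r : Fin n → ℝ) = r • Pi.single i 1 := by
    intro i r
    rw [← Pi.single_smul, smul_eq_mul, mul_one]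
  rw [weightedEdgePoint, h _ (w q.1.1 q.1.2), h _ (w q.1.2 q.1.1)]
  simp

/-- Face sets of weighted edge points on a hyperplane `∑ xᵢ = c` are cut out by linear
functionals. -/
theorem isFaceSet_weightedEdgePoint_iff {w : Fin n → Fin n → ℝ} {c : ℝ} (hc : c ≠ 0)
    (hw : ∀ i j, i < j → w i j + w j i = c) {T : Set (EdgeIndex n)} :
    IsFaceSet (weightedEdgePoint w) T ↔ ∃ b : Fin n → ℝ,
      (∀ q : EdgeIndex n, w q.1.1 q.1.2 * b q.1.1 + w q.1.2 q.1.1 * b q.1.2 ≤ 0) ∧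
      ∀ q : EdgeIndex n, q ∈ T ↔ w q.1.1 q.1.2 * b q.1.1 + w q.1.2 q.1.1 * b q.1.2 = 0 := by
  constructor
  · rintro ⟨l, c₀, hle, hiff⟩
    -- The constant `c₀` equals `c₀ / c` times the coordinate sum, so it is absorbed by shifting
    -- every coefficient.
    have key : ∀ q : EdgeIndex n, w q.1.1 q.1.2 * (l (Pi.single q.1.1 1) - c₀ / c) +
        w q.1.2 q.1.1 * (l (Pi.single q.1.2 1) - c₀ / c) = l (weightedEdgePoint w q) - c₀ := by
      intro q
      have h : c₀ = (w q.1.1 q.1.2 + w q.1.2 q.1.1) * (c₀ / c) := by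
        rw [hw _ _ q.2]; field_simp
      rw [map_weightedEdgePoint]
      linear_combination h
    refine ⟨fun i => l (Pi.single i 1) - c₀ / c, fun q => ?_, fun q => ?_⟩
    · rw [key]; exact sub_nonpos.2 (hle q)
    · rw [key, hiff, sub_eq_zero]
  · rintro ⟨b, hle, hiff⟩
    have key : ∀ q, Fintype.linearCombination ℝ b (weightedEdgePoint w q) =
        w q.1.1 q.1.2 * b q.1.1 + w q.1.2 q.1.1 * b q.1.2 := by
      intro q
      rw [map_weightedEdgePoint]
      simp [Fintype.linearCombination_apply_single]
    refine ⟨Fintype.linearCombination ℝ b, 0, fun q => ?_, fun q => ?_⟩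
    · rw [key]; exact hle q
    · rw [key]; exact hiff q

/-- If all `b i ≤ 0`, an edge lies in the face exactly when `b` vanishes at both ends, whatever the
weights. If `b k > 0`, all other `b j` are negative, so only edges at `k` can lie in the face, and
each `b j` can be adjusted separately to the new weights. -/
theorem IsFaceSet.weightedEdgePoint_congr {w w' : Fin n → Fin n → ℝ} {c c' : ℝ} (hc : c ≠ 0)
    (hc' : c' ≠ 0) (hw : ∀ i j, i < j → w i j + w j i = c)
    (hw' : ∀ i j, i < j → w' i j + w' j i = c') (hpos : ∀ i j, i ≠ j → 0 < w i j)
    (hpos' : ∀ i j, i ≠ j → 0 < w' i j) {T : Set (EdgeIndex n)}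
    (hT : IsFaceSet (weightedEdgePoint w) T) : IsFaceSet (weightedEdgePoint w') T := by
  rw [isFaceSet_weightedEdgePoint_iff hc hw] at hT
  rw [isFaceSet_weightedEdgePoint_iff hc' hw']
  obtain ⟨b, hle, hiff⟩ := hT
  have hle' : ∀ i j, i ≠ j → w i j * b i + w j i * b j ≤ 0 := by
    intro i j hij
    rcases lt_or_gt_of_ne hij with h | h
    · exact hle ⟨(i, j), h⟩
    · have := hle ⟨(j, i), h⟩
      simp only at this
      linarith
  -- It suffices that the two forms agree in sign on every edge.
  suffices h : ∃ b' : Fin n → ℝ, ∀ i j, i ≠ j →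
      (w' i j * b' i + w' j i * b' j < 0 ∧ w i j * b i + w j i * b j < 0) ∨
      ∃ r : ℝ, 0 < r ∧ w' i j * b' i + w' j i * b' j = r * (w i j * b i + w j i * b j) by
    obtain ⟨b', hb'⟩ := h
    refine ⟨b', fun q => ?_, fun q => ?_⟩
    · obtain h | ⟨r, hr, h⟩ := hb' q.1.1 q.1.2 q.2.ne
      · exact h.1.le
      · rw [h]; exact mul_nonpos_of_nonneg_of_nonpos hr.le (hle q)
    · rw [hiff]
      obtain h | ⟨r, hr, h⟩ := hb' q.1.1 q.1.2 q.2.ne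
      · exact ⟨fun h' => absurd h' h.2.ne, fun h' => absurd h' h.1.ne⟩
      · rw [h, mul_eq_zero, or_iff_right hr.ne']
  by_cases hb : ∀ i, b i ≤ 0
  · refine ⟨b, fun i j hij => ?_⟩
    have h1 := hpos i j hij
    have h2 := hpos j i hij.symm
    have h1' := hpos' i j hij
    have h2' := hpos' j i hij.symm
    rcases (hb i).lt_or_eq with hi | hi
    · refine Or.inl ⟨?_, ?_⟩
      · nlinarith [hb j]
      · nlinarith [hb j]
    rcases (hb j).lt_or_eq with hj | hj
    · refine Or.inl ⟨?_, ?_⟩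
      · nlinarith [hb i]
      · nlinarith [hb i]
    · exact Or.inr ⟨1, one_pos, by simp [hi, hj]⟩
  · push Not at hb
    obtain ⟨k, hk⟩ := hb
    have hneg : ∀ j, j ≠ k → b j < 0 := by
      intro j hj
      have h1 := mul_pos (hpos k j hj.symm) hk
      have h2 := hle' k j hj.symm
      exact (pos_iff_neg_of_mul_neg (by linarith : w j k * b j < 0)).1 (hpos j k hj)
    -- Solves for `b' j` so that the new form on the edge `kj` is `w' k j / (w k j * b k)` times the
    -- old one.
    let b' : Fin n → ℝ := fun j => if j = k then 1 else
      w' k j / w' j k * (w j k * b j / (w k j * b k))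
    have hb'k : b' k = 1 := if_pos rfl
    have hb'j : ∀ j, j ≠ k → b' j = w' k j / w' j k * (w j k * b j / (w k j * b k)) :=
      fun j hj => if_neg hj
    have hb'neg : ∀ j, j ≠ k → b' j < 0 := by
      intro j hj
      rw [hb'j j hj]
      exact mul_neg_of_pos_of_neg (div_pos (hpos' _ _ hj.symm) (hpos' _ _ hj))
        (div_neg_of_neg_of_pos (mul_neg_of_pos_of_neg (hpos _ _ hj) (hneg j hj))
          (mul_pos (hpos _ _ hj.symm) hk))
    have star : ∀ j, j ≠ k → 0 < w' k j / (w k j * b k) ∧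
        w' k j * b' k + w' j k * b' j = w' k j / (w k j * b k) * (w k j * b k + w j k * b j) := by
      intro j hj
      refine ⟨div_pos (hpos' _ _ hj.symm) (mul_pos (hpos _ _ hj.symm) hk), ?_⟩
      rw [hb'k, hb'j j hj]
      have h1 := (hpos' _ _ hj).ne'
      have h2 := (hpos _ _ hj.symm).ne'
      have h3 := hk.ne'
      field_simp
    refine ⟨b', fun i j hij => ?_⟩
    by_cases hi : i = k
    · subst hi
      exact Or.inr ⟨_, star j hij.symm⟩
    by_cases hj : j = k
    · subst hj
      obtain ⟨h1, h2⟩ := star i hi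
      exact Or.inr ⟨_, h1, by rw [add_comm, h2, add_comm (w i j * b i)]⟩
    · exact Or.inl ⟨add_neg (mul_neg_of_pos_of_neg (hpos' i j hij) (hb'neg i hi))
        (mul_neg_of_pos_of_neg (hpos' j i hij.symm) (hb'neg j hj)),
        add_neg (mul_neg_of_pos_of_neg (hpos i j hij) (hneg i hi))
        (mul_neg_of_pos_of_neg (hpos j i hij.symm) (hneg j hj))⟩

theorem hypersimplex_two_eq : hypersimplex n 2 =
    convexHull ℝ (range (weightedEdgePoint fun _ _ : Fin n => 1)) := by
  classical
  unfold hypersimplex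
  congr 1
  ext x
  constructor
  · rintro ⟨h01, hsum⟩
    have hx : x = fun i => if i ∈ Finset.univ.filter (fun i => x i = 1) then 1 else 0 := by
      ext i
      rcases h01 i with h | h <;> simp [h]
    have hcard : (Finset.univ.filter fun i => x i = 1).card = 2 := by
      rw [hx, Finset.sum_ite_mem] at hsum
      simp only [Finset.univ_inter, Finset.sum_const, nsmul_eq_mul, mul_one] at hsum
      exact_mod_cast hsum
    obtain ⟨i, j, hij, hs⟩ := Finset.card_eq_two.1 hcard
    rw [hs] at hx
    have hx' : x = Pi.single i 1 + Pi.single j 1 := by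
      rw [hx]
      ext k
      by_cases h1 : k = i
      · subst h1; simp [hij]
      · by_cases h2 : k = j
        · subst h2; simp [h1]
        · simp [h1, h2]
    rcases lt_or_gt_of_ne hij with h | h
    · exact ⟨⟨(i, j), h⟩, hx'.symm⟩
    · exact ⟨⟨(j, i), h⟩, by rw [hx', add_comm]; rfl⟩
  · rintro ⟨q, rfl⟩
    have hq := q.2.ne
    refine ⟨fun k => ?_, ?_⟩
    · by_cases h1 : k = q.1.1
      · right; simp [weightedEdgePoint, h1, hq]
      · by_cases h2 : k = q.1.2
        · right; simp [weightedEdgePoint, h2, hq.symm]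
        · left; simp [weightedEdgePoint, h1, h2]
    · simp [weightedEdgePoint, Finset.sum_add_distrib]
      norm_num

theorem edgePointHull_eq_convexHull_range (p : Fin n → Fin n → (Fin n → ℝ)) :
    edgePointHull p = convexHull ℝ (range fun q : EdgeIndex n => p q.1.1 q.1.2) := by
  unfold edgePointHull
  congr 1
  ext x
  constructor
  · rintro ⟨i, j, hij, rfl⟩
    exact ⟨⟨(i, j), hij⟩, rfl⟩
  · rintro ⟨q, rfl⟩
    exact ⟨_, _, q.2, rfl⟩

theorem IsEdgePointChoice.exists_weights {p : Fin n → Fin n → (Fin n → ℝ)}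
    (hp : IsEdgePointChoice p) : ∃ w : Fin n → Fin n → ℝ, (∀ i j, i < j → w i j + w j i = 1) ∧
      (∀ i j, i ≠ j → 0 < w i j) ∧
      (fun q : EdgeIndex n => p q.1.1 q.1.2) = weightedEdgePoint w := by
  choose! a b ha hb hab hp using hp
  -- `w i j` is the coefficient of `e_i` in the point on the edge `{i, j}`, in either order.
  refine ⟨fun i j => if i < j then a i j else b j i, fun i j hij => ?_, fun i j hij => ?_, ?_⟩
  · simp [hij, hij.not_gt, hab i j hij]
  · rcases lt_or_gt_of_ne hij with h | h
    · simp [h, ha]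
    · simp [h.not_gt, hb j i h]
  · ext q k
    have h := q.2
    rw [← hp _ _ q.2, weightedEdgePoint]
    simp [h, h.not_gt, Pi.single_apply]

theorem isCombinatorialHypersimplex_edgePointHull {p : Fin n → Fin n → (Fin n → ℝ)}
    (hp : IsEdgePointChoice p) : IsCombinatorialHypersimplex n 2 (edgePointHull p) := by
  obtain ⟨w, hsum, hpos, hw⟩ := hp.exists_weights
  rw [edgePointHull_eq_convexHull_range, hw]
  refine ⟨⟨_, finite_range _, rfl⟩, ⟨?_⟩⟩
  rw [hypersimplex_two_eq]
  refine (faceLatticeIso _).trans (OrderIso.trans ?_ (faceLatticeIso _).symm)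
  refine OrderIso.setCongr {T | IsFaceSet (weightedEdgePoint w) T}
    {T | IsFaceSet (weightedEdgePoint fun _ _ : Fin n => 1) T} ?_
  have h2 : ∀ i j : Fin n, i < j → (1 : ℝ) + 1 = 2 := fun _ _ _ => one_add_one_eq_two
  ext T
  exact ⟨fun h => h.weightedEdgePoint_congr one_ne_zero two_ne_zero hsum h2 hpos
      (fun _ _ _ => one_pos),
    fun h => h.weightedEdgePoint_congr two_ne_zero one_ne_zero h2 hsum (fun _ _ _ => one_pos) hpos⟩

end WeightedEdgePoint

/-! ### Projective maps and homogenized functionals -/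

section Projective

variable {ι E F : Type*} [AddCommGroup E] [Module ℝ E] [AddCommGroup F] [Module ℝ F]

theorem map_prodMk_one_sum [Fintype ι] (L : (E × ℝ) →ₗ[ℝ] F) (v : ι → E) {w : ι → ℝ}
    (hw : ∑ i, w i = 1) : L (∑ i, w i • v i, 1) = ∑ i, w i • L (v i, 1) := by
  have : (∑ i, w i • v i, (1 : ℝ)) = ∑ i, w i • (v i, (1 : ℝ)) := by
    ext
    · simp [Prod.fst_sum]
    · simp [Prod.snd_sum, hw]
  rw [this, map_sum]
  simp only [map_smul]

/-- An admissible projective transformation commutes with taking convex hulls of finite families. -/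
theorem projective_image_convexHull [Fintype ι] (L : (E × ℝ) →ₗ[ℝ] (F × ℝ)) {v : ι → E}
    (hL : ∀ x ∈ convexHull ℝ (range v), 0 < (L (x, 1)).2) :
    (fun x : E => ((L (x, 1)).2)⁻¹ • (L (x, 1)).1) '' convexHull ℝ (range v) =
      convexHull ℝ (range fun i => ((L (v i, 1)).2)⁻¹ • (L (v i, 1)).1) := by
  have hv : ∀ i, 0 < (L (v i, 1)).2 := fun i => hL _ (subset_convexHull ℝ _ (mem_range_self i))
  ext y
  constructor
  · rintro ⟨x, hx, rfl⟩
    have hD := hL x hx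
    obtain ⟨w, h0, h1, rfl⟩ := mem_convexHull_range_iff.1 hx
    have hx' := map_prodMk_one_sum L v h1
    -- Each weight is multiplied by the denominator at its vertex and divided by the denominator at
    -- the point.
    refine mem_convexHull_range_iff.2 ⟨fun i => (L (∑ i, w i • v i, 1)).2⁻¹ *
      (w i * (L (v i, 1)).2), fun i => ?_, ?_, ?_⟩
    · exact mul_nonneg (inv_nonneg.2 hD.le) (mul_nonneg (h0 i) (hv i).le)
    · have : ∑ i, w i * (L (v i, 1)).2 = (L (∑ i, w i • v i, 1)).2 := by
        rw [hx']; simp [Prod.snd_sum]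
      rw [← Finset.mul_sum, this, inv_mul_cancel₀ hD.ne']
    · have : (L (∑ i, w i • v i, 1)).1 = ∑ i, w i • (L (v i, 1)).1 := by
        rw [hx']; simp [Prod.fst_sum]
      simp only
      rw [this, Finset.smul_sum]
      refine Finset.sum_congr rfl fun i _ => ?_
      rw [smul_smul, smul_smul]
      congr 1
      rw [mul_assoc, mul_assoc, mul_inv_cancel₀ (hv i).ne', mul_one]
  · intro hy
    obtain ⟨w, h0, h1, rfl⟩ := mem_convexHull_range_iff.1 hy
    -- For the preimage, weights are divided by the vertex denominators and normalized by `S`; the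
    -- denominator there is then `S⁻¹`.
    set S : ℝ := ∑ i, w i * (L (v i, 1)).2⁻¹ with hS
    have hSpos : 0 < S := by
      have h0' : ∀ i, 0 ≤ w i * (L (v i, 1)).2⁻¹ := fun i =>
        mul_nonneg (h0 i) (inv_nonneg.2 (hv i).le)
      refine (Finset.sum_nonneg fun i _ => h0' i).lt_of_ne' fun h => ?_
      have hz := (Finset.sum_eq_zero_iff_of_nonneg fun i _ => h0' i).1 h
      have : ∑ i, w i = 0 := Finset.sum_eq_zero fun i hi =>
        (mul_eq_zero.1 (hz i hi)).resolve_right (inv_pos.2 (hv i)).ne'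
      linarith
    let u : ι → ℝ := fun i => S⁻¹ * (w i * (L (v i, 1)).2⁻¹)
    have hu1 : ∑ i, u i = 1 := by
      simp only [u]
      rw [← Finset.mul_sum, ← hS, inv_mul_cancel₀ hSpos.ne']
    refine ⟨∑ i, u i • v i, mem_convexHull_range_iff.2 ⟨u, fun i => ?_, hu1, rfl⟩, ?_⟩
    · exact mul_nonneg (inv_nonneg.2 hSpos.le) (mul_nonneg (h0 i) (inv_nonneg.2 (hv i).le))
    · have hx := map_prodMk_one_sum L v hu1
      have h2 : (L (∑ i, u i • v i, 1)).2 = S⁻¹ := by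
        rw [hx]
        simp only [Prod.snd_sum, Prod.smul_snd, smul_eq_mul, u]
        have : ∀ i, S⁻¹ * (w i * (L (v i, 1)).2⁻¹) * (L (v i, 1)).2 = S⁻¹ * w i := fun i => by
          rw [mul_assoc, inv_mul_cancel_right₀ (hv i).ne']
        simp only [this]
        rw [← Finset.mul_sum, h1, mul_one]
      have h3 : (L (∑ i, u i • v i, 1)).1 = ∑ i, u i • (L (v i, 1)).1 := by
        rw [hx]; simp [Prod.fst_sum]
      simp only
      rw [h2, h3, inv_inv, Finset.smul_sum]
      refine Finset.sum_congr rfl fun i _ => ?_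
      rw [smul_smul, smul_smul]
      congr 1
      simp only [u]
      rw [mul_inv_cancel_left₀ hSpos.ne']

/-- Homogenization: the affine function `c - l` becomes linear on `E × ℝ`, so such functionals can
serve as coordinates of a projective map. -/
theorem isFaceSet_iff_exists_prod {v : ι → E} {T : Set ι} :
    IsFaceSet v T ↔ ∃ f : (E × ℝ) →ₗ[ℝ] ℝ,
      (∀ i, 0 ≤ f (v i, 1)) ∧ ∀ i, i ∈ T ↔ f (v i, 1) = 0 := by
  constructor
  · rintro ⟨l, c, hle, hiff⟩
    have key : ∀ i, (c • LinearMap.snd ℝ E ℝ - l.comp (LinearMap.fst ℝ E ℝ)) (v i, 1) =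
        c - l (v i) := fun i => by simp
    refine ⟨c • LinearMap.snd ℝ E ℝ - l.comp (LinearMap.fst ℝ E ℝ), fun i => ?_, fun i => ?_⟩
    · rw [key]; exact sub_nonneg.2 (hle i)
    · rw [key, hiff, sub_eq_zero, eq_comm]
  · rintro ⟨f, hle, hiff⟩
    have key : ∀ i, f (v i, 1) = f (0, 1) - (-f.comp (LinearMap.inl ℝ E ℝ)) (v i) := by
      intro i
      have : ((v i, 1) : E × ℝ) = (v i, 0) + (0, 1) := by simp
      rw [this, map_add]
      simp [add_comm]
    refine ⟨-f.comp (LinearMap.inl ℝ E ℝ), f (0, 1), fun i => ?_, fun i => ?_⟩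
    · have := hle i
      rw [key] at this
      exact sub_nonneg.1 this
    · rw [hiff, key, sub_eq_zero, eq_comm]

/-- If the face on which the nonnegative functional `f` vanishes is maximal among the proper faces
of a finite family, then every functional vanishing on it is a multiple of `f` on the family. -/
theorem exists_eq_mul_of_maximal_face [Finite ι] {u : ι → E} {f m : E →ₗ[ℝ] ℝ}
    (hf : ∀ i, 0 ≤ f (u i))
    (hmax : ∀ g : E →ₗ[ℝ] ℝ, (∀ i, 0 ≤ g (u i)) → (∀ i, f (u i) = 0 → g (u i) = 0) →
      (∃ i, f (u i) ≠ 0 ∧ g (u i) = 0) → ∀ i, g (u i) = 0)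
    (hm : ∀ i, f (u i) = 0 → m (u i) = 0) : ∃ r : ℝ, ∀ i, m (u i) = r * f (u i) := by
  rcases {i | f (u i) ≠ 0}.eq_empty_or_nonempty with h | h
  · refine ⟨0, fun i => ?_⟩
    have : f (u i) = 0 := by
      by_contra h'
      exact (h ▸ h' : i ∈ (∅ : Set ι))
    rw [hm i this, zero_mul]
  -- With `r` the least ratio `m / f`, the functional `m - r f` is nonnegative and vanishes at the
  -- extra point `i₀`, so maximality makes it vanish on the whole family.
  · obtain ⟨i₀, hi₀, hmin⟩ := exists_min_image _ (fun i => m (u i) / f (u i)) (toFinite _) h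
    refine ⟨m (u i₀) / f (u i₀), fun i => ?_⟩
    have := hmax (m - (m (u i₀) / f (u i₀)) • f) (fun i => ?_) (fun i hi => ?_) ⟨i₀, hi₀, ?_⟩ i
    · simpa [sub_eq_zero] using this
    · by_cases hi : f (u i) = 0
      · simp [hi, hm i hi]
      · have h1 := hmin i hi
        rw [le_div_iff₀ ((hf i).lt_of_ne' hi)] at h1
        simpa using h1
    · simp [hi, hm i hi]
    · have : f (u i₀) ≠ 0 := hi₀
      simp [this]

end Projective

/-! ### Particular faces of the hypersimplex -/

section Standard

variable {n : ℕ}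

theorem isFaceSet_standard_iff {T : Set (EdgeIndex n)} :
    IsFaceSet (weightedEdgePoint fun _ _ : Fin n => 1) T ↔ ∃ b : Fin n → ℝ,
      (∀ q : EdgeIndex n, b q.1.1 + b q.1.2 ≤ 0) ∧
      ∀ q : EdgeIndex n, q ∈ T ↔ b q.1.1 + b q.1.2 = 0 := by
  rw [isFaceSet_weightedEdgePoint_iff (c := 2) two_ne_zero fun _ _ _ => one_add_one_eq_two]
  simp only [one_mul]

theorem isFaceSet_standard_singleton (q : EdgeIndex n) :
    IsFaceSet (weightedEdgePoint fun _ _ : Fin n => 1) {q} := by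
  rw [isFaceSet_standard_iff]
  refine ⟨fun i => if i = q.1.1 ∨ i = q.1.2 then 0 else -1, fun q' => ?_, fun q' => ?_⟩
  · simp only
    split_ifs <;> norm_num
  · obtain ⟨⟨i, j⟩, h⟩ := q
    obtain ⟨⟨i', j'⟩, h'⟩ := q'
    simp only [mem_singleton_iff, Subtype.mk.injEq, Prod.mk.injEq] at h h' ⊢
    split_ifs <;> norm_num <;> lia

theorem isFaceSet_standard_avoiding (k : Fin n) :
    IsFaceSet (weightedEdgePoint fun _ _ : Fin n => 1) {q | q.1.1 ≠ k ∧ q.1.2 ≠ k} := by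
  rw [isFaceSet_standard_iff]
  refine ⟨fun i => if i = k then -1 else 0, fun q' => ?_, fun q' => ?_⟩
  · simp only
    split_ifs <;> norm_num
  · simp only [mem_ofPred_eq]
    split_ifs with h1 h2 h2 <;> simp [h1, h2]

/-- The star of `k` forces `b j = -b k` for all `j ≠ k`; an edge off `k` then gives `-2 b k = 0`, so
`b = 0`. This makes the star a maximal proper face. -/
theorem eq_univ_of_isFaceSet_standard_of_star {T : Set (EdgeIndex n)}
    (hT : IsFaceSet (weightedEdgePoint fun _ _ : Fin n => 1) T) (k : Fin n)
    (hstar : ∀ q : EdgeIndex n, q.1.1 = k ∨ q.1.2 = k → q ∈ T) {q₀ : EdgeIndex n} (hq₀ : q₀ ∈ T)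
    (h₁ : q₀.1.1 ≠ k) (h₂ : q₀.1.2 ≠ k) : T = univ := by
  obtain ⟨b, -, hb⟩ := isFaceSet_standard_iff.1 hT
  have hk : ∀ j, j ≠ k → b j = -b k := by
    intro j hj
    rcases lt_or_gt_of_ne hj with h | h
    · have := (hb ⟨(j, k), h⟩).1 (hstar _ (Or.inr rfl))
      simp only at this
      linarith
    · have := (hb ⟨(k, j), h⟩).1 (hstar _ (Or.inl rfl))
      simp only at this
      linarith
  have h0 := (hb q₀).1 hq₀
  have e1 := hk _ h₁
  have e2 := hk _ h₂
  have hz : ∀ j, b j = 0 := by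
    intro j
    by_cases hj : j = k
    · rw [hj]; linarith
    · rw [hk j hj]; linarith
  ext q
  simp [hb, hz]

end Standard

/-! ### Realization in the edges of the simplex -/

section Realization

variable {n : ℕ} {E : Type*} [AddCommGroup E] [Module ℝ E]

theorem sum_mul_apply_edge {V : Type*} {u : EdgeIndex n → V} {f : Fin n → V → ℝ}
    (hf : ∀ k q, (q.1.1 ≠ k ∧ q.1.2 ≠ k) → f k (u q) = 0) (γ : Fin n → ℝ) (q : EdgeIndex n) :
    ∑ k, γ k * f k (u q) =
      γ q.1.1 * f q.1.1 (u q) + γ q.1.2 * f q.1.2 (u q) := by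
  refine Fintype.sum_eq_add _ _ q.2.ne fun k hk => ?_
  rw [hf k q ⟨hk.1.symm, hk.2.symm⟩, mul_zero]

/-- The functionals `f k`, each supporting the face of edges that avoid `k`, have no common zero on
the span of the family, provided the star of the vertex `0` is a maximal proper face. -/
theorem eq_zero_of_forall_apply_eq_zero [NeZero n] {u : EdgeIndex n → E} {f : Fin n → E →ₗ[ℝ] ℝ}
    (hf0 : ∀ k q, 0 ≤ f k (u q)) (hf : ∀ k q, (q.1.1 ≠ k ∧ q.1.2 ≠ k) ↔ f k (u q) = 0)
    (hmax : ∀ g : E →ₗ[ℝ] ℝ, (∀ q, 0 ≤ g (u q)) → (∀ q, q.1.1 = 0 → g (u q) = 0) →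
      (∃ q, q.1.1 ≠ 0 ∧ g (u q) = 0) → ∀ q, g (u q) = 0)
    {y : E} (hy : y ∈ Submodule.span ℝ (range u)) (hfy : ∀ k, f k y = 0) : y = 0 := by
  classical
  have hpos : ∀ q : EdgeIndex n, 0 < f q.1.1 (u q) ∧ 0 < f q.1.2 (u q) := fun q =>
    ⟨(hf0 _ q).lt_of_ne' fun h => ((hf _ q).2 h).1 rfl,
      (hf0 _ q).lt_of_ne' fun h => ((hf _ q).2 h).2 rfl⟩
  -- Chosen so that `∑ γ k • f k` cancels on every edge at `0`; on all other edges both contributing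
  -- terms are positive.
  let γ : Fin n → ℝ := fun k => if h : 0 < k then
    f 0 (u ⟨(0, k), h⟩) / f k (u ⟨(0, k), h⟩) else -1
  have hγ0 : γ 0 = -1 := dif_neg (lt_irrefl _)
  have hγ : ∀ k (h : 0 < k), γ k = f 0 (u ⟨(0, k), h⟩) / f k (u ⟨(0, k), h⟩) :=
    fun k h => dif_pos h
  have hγpos : ∀ k, 0 < k → 0 < γ k := fun k h => by
    rw [hγ k h]
    exact div_pos (hpos ⟨(0, k), h⟩).1 (hpos ⟨(0, k), h⟩).2
  let g : E →ₗ[ℝ] ℝ := ∑ k, γ k • f k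
  have hg : ∀ x, g x = ∑ k, γ k * f k x := fun x => by simp [g]
  have hgu : ∀ q, g (u q) = γ q.1.1 * f q.1.1 (u q) + γ q.1.2 * f q.1.2 (u q) := fun q => by
    rw [hg]
    exact sum_mul_apply_edge (f := fun k => f k) (fun k q => (hf k q).1) γ q
  have hg_star : ∀ q, q.1.1 = 0 → g (u q) = 0 := by
    rintro ⟨⟨i, j⟩, hq⟩ rfl
    rw [hgu]
    simp only
    rw [hγ0, hγ j hq, div_mul_cancel₀ _ (hpos ⟨(0, j), hq⟩).2.ne']
    ring
  have hg_pos : ∀ q, q.1.1 ≠ 0 → 0 < g (u q) := by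
    intro q hq
    have h1 : 0 < q.1.1 := Fin.pos_iff_ne_zero.2 hq
    rw [hgu]
    exact add_pos (mul_pos (hγpos _ h1) (hpos q).1)
      (mul_pos (hγpos _ (h1.trans q.2)) (hpos q).2)
  have hg_iff : ∀ q, g (u q) = 0 ↔ q.1.1 = 0 := fun q =>
    ⟨fun h => by_contra fun h' => (hg_pos q h').ne' h, hg_star q⟩
  -- Otherwise some `m` vanishes on the star but not at `y`. By maximality `m` is a multiple of `g`
  -- on the span, yet `g y = 0`.
  have hy_star : y ∈ Submodule.span ℝ (u '' {q | q.1.1 = 0}) := by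
    by_contra hny
    obtain ⟨m, hmy, hm⟩ := Submodule.exists_le_ker_of_notMem hny
    obtain ⟨r, hr⟩ := exists_eq_mul_of_maximal_face (u := u) (f := g) (m := m)
      (fun q => by
        by_cases h : q.1.1 = 0
        · exact (hg_star q h).ge
        · exact (hg_pos q h).le)
      (by simpa only [hg_iff, ne_eq] using hmax)
      (fun q hq => hm (Submodule.subset_span ⟨q, (hg_iff q).1 hq, rfl⟩))
    have heq : EqOn m (r • g : E →ₗ[ℝ] ℝ) (range u) := by
      rintro _ ⟨q, rfl⟩
      simpa using hr q
    apply hmy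
    rw [LinearMap.eqOn_span (g := r • g) heq hy]
    simp [hg, hfy]
  have himg : u '' {q | q.1.1 = 0} = u '' (Finset.univ.filter fun q : EdgeIndex n => q.1.1 = 0) := by
    simp
  rw [himg, Submodule.mem_span_image_finset_iff_exists_fun'] at hy_star
  obtain ⟨c, rfl⟩ := hy_star
  -- Among the edges at `0`, only `q` itself meets `q.1.2`, so `f q.1.2` isolates the coefficient of
  -- `u q`.
  refine Finset.sum_eq_zero fun q hq => ?_
  have hq0 : q.1.1 = 0 := (Finset.mem_filter.1 hq).2
  have h := hfy q.1.2
  rw [map_sum, Finset.sum_eq_single q, map_smul, smul_eq_mul] at h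
  · rw [(mul_eq_zero.1 h).resolve_right (hpos q).2.ne', zero_smul]
  · intro q' hq' hne
    have hq0' : q'.1.1 = 0 := (Finset.mem_filter.1 hq').2
    rw [map_smul, (hf q.1.2 q').1, smul_zero]
    refine ⟨fun h' => ?_, fun h' => hne (Subtype.ext (Prod.ext (hq0'.trans hq0.symm) h'))⟩
    have := q.2
    rw [← h', hq0', hq0] at this
    exact lt_irrefl _ this
  · exact fun h' => absurd hq h'

/-- A family with the face sets of the `(n,2)`-hypersimplex is mapped, by dividing the functionals
of the facets `xₖ = 0` by their sum, to points in the edges of the standard simplex. -/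
theorem exists_projectivelyEquivalent_edgePointHull [NeZero n] {v : EdgeIndex n → E}
    (hv : ∀ T, IsFaceSet v T ↔ IsFaceSet (weightedEdgePoint fun _ _ : Fin n => 1) T) :
    ∃ p : Fin n → Fin n → (Fin n → ℝ), IsEdgePointChoice p ∧
      ProjectivelyEquivalent (convexHull ℝ (range v)) (edgePointHull p) := by
  classical
  choose f hf0 hf using fun k : Fin n =>
    isFaceSet_iff_exists_prod.1 ((hv _).2 (isFaceSet_standard_avoiding k))
  simp only [mem_ofPred_eq] at hf
  have hpos : ∀ q : EdgeIndex n, 0 < f q.1.1 (v q, 1) ∧ 0 < f q.1.2 (v q, 1) := fun q =>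
    ⟨(hf0 _ q).lt_of_ne' fun h => ((hf _ q).2 h).1 rfl,
      (hf0 _ q).lt_of_ne' fun h => ((hf _ q).2 h).2 rfl⟩
  let L : (E × ℝ) →ₗ[ℝ] ((Fin n → ℝ) × ℝ) := (LinearMap.pi f).prod (∑ k, f k)
  have hL1 : ∀ y k, (L y).1 k = f k y := fun _ _ => rfl
  have hL2 : ∀ y, (L y).2 = ∑ k, f k y := fun y => by simp [L]
  have hLv : ∀ q, (L (v q, 1)).2 = f q.1.1 (v q, 1) + f q.1.2 (v q, 1) := fun q => by
    rw [hL2]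
    simpa using sum_mul_apply_edge (u := fun q => (v q, (1 : ℝ))) (f := fun k => f k)
      (fun k q => (hf k q).1) 1 q
  have hspan : Submodule.span ℝ ((fun x : E => (x, (1 : ℝ))) '' convexHull ℝ (range v)) ≤
      Submodule.span ℝ (range fun q => (v q, (1 : ℝ))) := by
    rw [Submodule.span_le]
    rintro _ ⟨x, hx, rfl⟩
    obtain ⟨w, -, h1, rfl⟩ := mem_convexHull_range_iff.1 hx
    have := map_prodMk_one_sum LinearMap.id v h1
    simp only [LinearMap.id_apply] at this
    simp only [this, SetLike.mem_coe]
    exact Submodule.sum_mem _ fun q _ => Submodule.smul_mem _ _ (Submodule.subset_span ⟨q, rfl⟩)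
  have hLpos : ∀ x ∈ convexHull ℝ (range v), 0 < (L (x, 1)).2 := by
    intro x hx
    obtain ⟨w, h0, h1, rfl⟩ := mem_convexHull_range_iff.1 hx
    rw [map_prodMk_one_sum L v h1]
    simp only [Prod.snd_sum, Prod.smul_snd, smul_eq_mul]
    obtain ⟨q, -, hq⟩ := Finset.exists_ne_zero_of_sum_ne_zero (h1 ▸ one_ne_zero)
    have hnonneg : ∀ q, 0 < (L (v q, 1)).2 := fun q => by
      rw [hLv]; exact add_pos (hpos q).1 (hpos q).2
    exact Finset.sum_pos' (fun q _ => mul_nonneg (h0 q) (hnonneg q).le)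
      ⟨q, Finset.mem_univ _, mul_pos ((h0 q).lt_of_ne' hq) (hnonneg q)⟩
  let φ : E → Fin n → ℝ := fun x => ((L (x, 1)).2)⁻¹ • (L (x, 1)).1
  let p : Fin n → Fin n → (Fin n → ℝ) := fun i j => if h : i < j then φ (v ⟨(i, j), h⟩) else 0
  have hp : (fun q : EdgeIndex n => p q.1.1 q.1.2) = fun q => φ (v q) := by
    ext1 q
    exact dif_pos q.2
  refine ⟨p, fun i j hij => ?_, L, ?_, hLpos, ?_⟩
  · let q : EdgeIndex n := ⟨(i, j), hij⟩
    have hpq : p i j = φ (v q) := dif_pos hij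
    obtain ⟨hi, hj⟩ := hpos q
    have hs := hLv q
    have hspos := add_pos hi hj
    refine ⟨((L (v q, 1)).2)⁻¹ * f i (v q, 1), ((L (v q, 1)).2)⁻¹ * f j (v q, 1),
      mul_pos (inv_pos.2 (hs ▸ hspos)) hi, mul_pos (inv_pos.2 (hs ▸ hspos)) hj, ?_, ?_⟩
    · rw [← mul_add, hs]
      exact inv_mul_cancel₀ hspos.ne'
    · rw [hpq]
      ext k
      simp only [φ, Pi.add_apply, Pi.smul_apply, smul_eq_mul, hL1, Pi.single_apply]
      have hne : i ≠ j := hij.ne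
      by_cases h1 : k = i
      · subst h1; simp [hne]
      · by_cases h2 : k = j
        · subst h2; simp [h1]
        · have : f k (v q, 1) = 0 := (hf k q).1 ⟨Ne.symm h1, Ne.symm h2⟩
          simp [h1, h2, this]
  · intro x hx y hy hxy
    rw [← sub_eq_zero]
    refine eq_zero_of_forall_apply_eq_zero (u := fun q => (v q, (1 : ℝ))) hf0 hf ?_
      (hspan (Submodule.sub_mem _ hx hy)) fun k => ?_
    -- The zero set of `g` is a face set containing the star of `0` and one more edge, hence
    -- everything.
    · intro g hg0 hgstar ⟨q, hq, hgq⟩ q'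
      have hT := (hv _).1 (isFaceSet_iff_exists_prod.2
        ⟨g, hg0, fun i => (Iff.rfl : i ∈ {i | g (v i, 1) = 0} ↔ _)⟩)
      have huniv := eq_univ_of_isFaceSet_standard_of_star hT 0 (fun q h => hgstar q ?_) hgq hq ?_
      · exact (huniv ▸ mem_univ q' : q' ∈ {i | g (v i, 1) = 0})
      · exact h.resolve_right ((Fin.zero_le _).trans_lt q.2).ne'
      · exact ((Fin.zero_le _).trans_lt q.2).ne'
    · rw [map_sub, sub_eq_zero, ← hL1, ← hL1, hxy]
  · rw [edgePointHull_eq_convexHull_range, hp]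
    exact projective_image_convexHull L hLpos

end Realization

theorem mainTheorem9 (n : ℕ) (hn : 4 ≤ n) :
    (∀ p : Fin n → Fin n → (Fin n → ℝ), IsEdgePointChoice p →
      IsCombinatorialHypersimplex n 2 (edgePointHull p)) ∧
    (∀ (d : ℕ) (Q : Set (Fin d → ℝ)), IsCombinatorialHypersimplex n 2 Q →
      ∃ p : Fin n → Fin n → (Fin n → ℝ), IsEdgePointChoice p ∧
        ProjectivelyEquivalent Q (edgePointHull p)) := by
  have : NeZero n := ⟨by lia⟩
  refine ⟨fun p hp => isCombinatorialHypersimplex_edgePointHull hp, ?_⟩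
  rintro d Q ⟨⟨S, hS, rfl⟩, ⟨Φ⟩⟩
  rw [hypersimplex_two_eq] at Φ
  obtain ⟨v, hQ, hv⟩ := exists_family_of_orderIso (hS.isCompact_convexHull ℝ)
    (convex_convexHull ℝ S) isFaceSet_standard_singleton (Φ.trans (faceLatticeIso _))
  rw [hQ]
  exact exists_projectivelyEquivalent_edgePointHull hv
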